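/- Notation. For real $y\ge 2$ and $x>0$ put $u=\log x/\log y$. Let $\mathcal S_y$ be the set of $y$-smooth positive integers (all prime factors at most $y$), let $\Psi(x,y)=|\mathcal S_y\cap[1,x]|$, and let $\Phi(x,y)$ be the number of positive integers $n\le x$ all of whose prime factors exceed $y$. Let $\rho$ be Dickman's function: $\rho(u)=0$ for $u<0$, $\rho(u)=1$ for $0\le u\le 1$, $\rho$ is continuous on $[0,\infty)$ and $u\rho'(u)=-\rho(u-1)$ for $u>1$; $\rho'$ is defined by right-continuity at $u=0,1$. Let $\omega$ be Buchstab's function: $\omega(u)=0$ for $u<1$, $u\omega(u)=1$ for $1\le u\le 2$, $\omega$ is continuous on $[1,\infty)$ and $(u\omega(u))'=\omega(u-1)$ for $u>2$. Let $\{t\}$ denote the fractional part of $t$, and define $$\Lambda(x,y)=x\rho(u)-\{x\}-x\int_0^u\rho'(u-v)\frac{\{y^v\}}{y^v}\,dv\quad(x\ge 1),\qquad \Delta(x,y)=\Psi(x,y)-\Lambda(x,y),$$ $$\Pi(y)=\prod_{p\le y}\Bigl(1-\frac1p\Bigr),\qquad Q^*(x,y)=1_{x\ge 1}+x\int_0^u\omega(u-v)y^{-v}\,dv-\Phi(x,y),\qquad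 R^*(x,y)=\sum_{n\in\mathcal S_y}Q^*(x/n,y).$$ Statement. Let $X\ge 1$, $y\ge 2$ and $f(y)>0$. If $$|\Delta(x,y)|\le x f(y)\rho(u)\qquad(1\le x\le X),$$ then $$|R^*(x,y)|\le x f(y)\qquad(1\le x\le X)$$ and $$|Q^*(x,y)|\le x f(y)\,\Pi(y)^{-1}\qquad(1\le x\le X).$$ -/

import Mathlib

noncomputable section

/-- Successive approximations to Dickman's function (method of steps): stage `n` has the
correct values on `(-∞, n + 1]`. -/
def dickmanStage : ℕ → ℝ → ℝ
  | 0, u => if u < 0 then 0 else 1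
  | n + 1, u => if u < 0 then 0 else if u ≤ 1 then 1 else
      1 - ∫ t in (1 : ℝ)..u, dickmanStage n (t - 1) / t

/-- Dickman's function `ρ`: `ρ(u) = 0` for `u < 0`, `ρ(u) = 1` for `0 ≤ u ≤ 1`, and
`ρ(u) = 1 - ∫_1^u ρ(t - 1) / t dt` for `u > 1` (see the lemmas below), i.e. `ρ` is continuous on
`[0, ∞)` and `u ρ'(u) = -ρ(u - 1)` for `u > 1`. -/
def dickmanRho (u : ℝ) : ℝ := dickmanStage ⌊u⌋₊ u

/-- The derivative `ρ'` of Dickman's function, taken from the right; this is the usual derivative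
except at `u = 0, 1`, where it is the value given by right-continuity. -/
def dickmanRhoDeriv (u : ℝ) : ℝ := derivWithin dickmanRho (Set.Ici u) u

/-- Successive approximations to Buchstab's function (method of steps): stage `n` has the
correct values on `(-∞, n + 2]`. -/
def buchstabStage : ℕ → ℝ → ℝ
  | 0, u => if u < 1 then 0 else 1 / u
  | n + 1, u => if u < 1 then 0 else if u ≤ 2 then 1 / u else
      (1 + ∫ t in (1 : ℝ)..(u - 1), buchstabStage n t) / u

/-- Buchstab's function `ω`: `ω(u) = 0` for `u < 1`, `ω(u) = 1 / u` for `1 ≤ u ≤ 2`, and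
`u ω(u) = 1 + ∫_1^{u-1} ω(t) dt` for `u > 2` (see the lemmas below), i.e. `ω` is continuous on
`[1, ∞)` and `(u ω(u))' = ω(u - 1)` for `u > 2`. -/
def buchstabOmega (u : ℝ) : ℝ := buchstabStage ⌊u⌋₊ u

theorem dickmanStage_eq (m n : ℕ) (u : ℝ) (hm : u ≤ m + 1) (hn : u ≤ n + 1) :
    dickmanStage m u = dickmanStage n u := by
  induction m generalizing n u with
  | zero =>
    cases n with
    | zero => rfl
    | succ n =>
      have h1 : u ≤ 1 := by simpa using hm
      simp [dickmanStage, h1]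
  | succ m ih =>
    cases n with
    | zero =>
      have h1 : u ≤ 1 := by simpa using hn
      simp [dickmanStage, h1]
    | succ n =>
      push_cast at hm hn
      simp only [dickmanStage]
      split_ifs with h0 h1
      · rfl
      · rfl
      · congr 1
        refine intervalIntegral.integral_congr fun t ht => ?_
        rw [Set.uIcc_of_le (by linarith)] at ht
        rw [ih n (t - 1) (by linarith [ht.2]) (by linarith [ht.2])]

theorem dickmanRho_eq_stage (n : ℕ) (u : ℝ) (hn : u ≤ n + 1) :
    dickmanRho u = dickmanStage n u :=
  dickmanStage_eq _ _ _ (Nat.lt_floor_add_one u).le hn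

theorem dickmanRho_of_neg (u : ℝ) (hu : u < 0) : dickmanRho u = 0 := by
  rw [dickmanRho_eq_stage 0 u (by push_cast; linarith)]
  simp [dickmanStage, hu]

theorem dickmanRho_of_le_one (u : ℝ) (h0 : 0 ≤ u) (h1 : u ≤ 1) : dickmanRho u = 1 := by
  rw [dickmanRho_eq_stage 0 u (by push_cast; linarith)]
  simp [dickmanStage, not_lt.mpr h0]

theorem dickmanRho_of_one_lt (u : ℝ) (hu : 1 < u) :
    dickmanRho u = 1 - ∫ t in (1 : ℝ)..u, dickmanRho (t - 1) / t := by
  have hf : u ≤ ⌊u⌋₊ + 1 := (Nat.lt_floor_add_one u).le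
  rw [dickmanRho_eq_stage (⌊u⌋₊ + 1) u (by push_cast; linarith)]
  simp only [dickmanStage, not_lt.mpr (zero_le_one.trans hu.le), not_le.mpr hu, if_false]
  congr 1
  refine intervalIntegral.integral_congr fun t ht => ?_
  rw [Set.uIcc_of_le hu.le] at ht
  rw [dickmanRho_eq_stage ⌊u⌋₊ (t - 1) (by linarith [ht.2])]

theorem buchstabStage_eq (m n : ℕ) (u : ℝ) (hm : u ≤ m + 2) (hn : u ≤ n + 2) :
    buchstabStage m u = buchstabStage n u := by
  induction m generalizing n u with
  | zero =>
    cases n with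
    | zero => rfl
    | succ n =>
      have h1 : u ≤ 2 := by simpa using hm
      simp [buchstabStage, h1]
  | succ m ih =>
    cases n with
    | zero =>
      have h1 : u ≤ 2 := by simpa using hn
      simp [buchstabStage, h1]
    | succ n =>
      push_cast at hm hn
      simp only [buchstabStage]
      split_ifs with h0 h1
      · rfl
      · rfl
      · congr 2
        refine intervalIntegral.integral_congr fun t ht => ?_
        rw [Set.uIcc_of_le (by linarith)] at ht
        exact ih n t (by linarith [ht.2]) (by linarith [ht.2])

theorem buchstabOmega_eq_stage (n : ℕ) (u : ℝ) (hn : u ≤ n + 2) :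
    buchstabOmega u = buchstabStage n u :=
  buchstabStage_eq _ _ _ (by linarith [Nat.lt_floor_add_one u]) hn

theorem buchstabOmega_of_lt_one (u : ℝ) (hu : u < 1) : buchstabOmega u = 0 := by
  rw [buchstabOmega_eq_stage 0 u (by push_cast; linarith)]
  simp [buchstabStage, hu]

theorem buchstabOmega_of_le_two (u : ℝ) (h1 : 1 ≤ u) (h2 : u ≤ 2) :
    buchstabOmega u = 1 / u := by
  rw [buchstabOmega_eq_stage 0 u (by push_cast; linarith)]
  simp [buchstabStage, not_lt.mpr h1]

theorem buchstabOmega_of_two_lt (u : ℝ) (hu : 2 < u) :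
    buchstabOmega u = (1 + ∫ t in (1 : ℝ)..(u - 1), buchstabOmega t) / u := by
  have hf : u ≤ ⌊u⌋₊ + 1 := (Nat.lt_floor_add_one u).le
  rw [buchstabOmega_eq_stage (⌊u⌋₊ + 1) u (by push_cast; linarith)]
  simp only [buchstabStage, not_lt.mpr (one_le_two.trans hu.le), not_le.mpr hu, if_false]
  congr 2
  refine intervalIntegral.integral_congr fun t ht => ?_
  rw [Set.uIcc_of_le (by linarith)] at ht
  exact (buchstabOmega_eq_stage ⌊u⌋₊ t (by linarith [ht.2])).symm

/-- The set `S_y` of `y`-smooth positive integers: all prime factors are at most `y`. -/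
def smoothSet (y : ℝ) : Set ℕ := {n | 1 ≤ n ∧ ∀ p : ℕ, p.Prime → p ∣ n → (p : ℝ) ≤ y}

/-- The set of `y`-rough positive integers: all prime factors exceed `y`. -/
def roughSet (y : ℝ) : Set ℕ := {n | 1 ≤ n ∧ ∀ p : ℕ, p.Prime → p ∣ n → y < (p : ℝ)}

/-- `Ψ(x, y)`, the number of `y`-smooth positive integers up to `x`. -/
def smoothCount (x y : ℝ) : ℝ := ({n : ℕ | n ∈ smoothSet y ∧ (n : ℝ) ≤ x}.ncard : ℝ)

/-- `Φ(x, y)`, the number of `y`-rough positive integers up to `x`. -/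
def roughCount (x y : ℝ) : ℝ := ({n : ℕ | n ∈ roughSet y ∧ (n : ℝ) ≤ x}.ncard : ℝ)

/-- `u = log x / log y`. -/
def logRatio (x y : ℝ) : ℝ := Real.log x / Real.log y

/-- De Bruijn's approximation `Λ(x, y)` to `Ψ(x, y)`. -/
def deBruijnLambda (x y : ℝ) : ℝ :=
  x * dickmanRho (logRatio x y) - Int.fract x
    - x * ∫ v in (0 : ℝ)..logRatio x y,
        dickmanRhoDeriv (logRatio x y - v) * (Int.fract (y ^ v) / y ^ v)

/-- `Δ(x, y) = Ψ(x, y) - Λ(x, y)`. -/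
def smoothError (x y : ℝ) : ℝ := smoothCount x y - deBruijnLambda x y

/-- `μ_y(u) = ∫_0^u ω(u - v) y^{-v} dv`. -/
def muY (y u : ℝ) : ℝ := ∫ v in (0 : ℝ)..u, buchstabOmega (u - v) * y ^ (-v)

/-- `Π(y) = ∏_{p ≤ y} (1 - 1/p)`. -/
def primeProd (y : ℝ) : ℝ :=
  ∏ p ∈ (Finset.Icc 1 ⌊y⌋₊).filter Nat.Prime, (1 - 1 / (p : ℝ))

/-- `V*(x, y) = 1_{x ≥ 1} + x μ_y(u)`. -/
def VStar (x y : ℝ) : ℝ := Set.indicator (Set.Ici 1) 1 x + x * muY y (logRatio x y)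

/-- `Q*(x, y) = V*(x, y) - Φ(x, y)`. -/
def QStar (x y : ℝ) : ℝ := VStar x y - roughCount x y

/-- `R*(x, y) = ∑_{n ∈ S_y} Q*(x / n, y)`; for `y ≥ 2` only finitely many terms are nonzero, since
`Q*(t, y) = 0` for `0 < t ≤ y`. -/
def RStar (x y : ℝ) : ℝ := ∑' n : smoothSet y, QStar (x / (n : ℕ)) y

end

/-! In the variable `v = log x / log y`, division of `x` by `n` becomes translation by `log n / log
y`, and the integrals become convolutions of functions supported on `[0, ∞)`. Write `δ₀` for the
unit of convolution, `H` for the Heaviside function, `ψ(v) = Ψ(y^v, y) / y^v` and `λ(v) = Λ(y^v, y)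
/ y^v`.

The key fact is that `δ₀ + ω` and `δ₀ + ρ'` are inverse to each other
(`buchstabOmega_add_dickmanRhoDeriv_add_conv`). Since `λ = (δ₀ + ρ') * a` with `a(v) = ⌊y^v⌋ / y^v`,
convolving with `δ₀ + ω` returns `a` (`add_conv_buchstabOmega`). Likewise `ρ = (δ₀ + ρ') * H` gives
`ρ + ω * ρ = 1` on `[0, ∞)`.

Summing `V*(x/n, y)` over smooth `n` gives `x (ψ + ω * ψ)(u)`. Summing `Φ(x/n, y)` gives `⌊x⌋`,
because every integer factors uniquely as smooth times rough (`RStar_rpow_eq`). Since `⌊x⌋ = x (λ +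
ω * λ)(u)`, it follows that `R*(x, y) / x = (δ₀ + ω) * (ψ - λ)`. The hypothesis says `|ψ - λ| ≤ f
ρ`, and `ω ≥ 0`, so this is at most `f (ρ + ω * ρ) = f` (`abs_RStar_le`).

For `Q*`, Möbius inversion over the divisors `d` of the product of the primes up to `y` gives `Q*(x,
y) = ∑ μ(d) R*(x/d, y)` (`QStar_eq_sum_moebius`). The bound for `R*` then costs a factor `∑ 1/d = ∏
(1 + 1/p) ≤ Π(y)⁻¹`. -/

open MeasureTheory
open scoped Convolution

/-! ### Convolution of causal functions. -/

/-- Measurable functions vanishing on the negative reals and bounded on every left half-line. -/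
structure CausalBdd (f : ℝ → ℝ) : Prop where
  measurable : Measurable f
  bdd : ∀ a, ∃ C, ∀ x ≤ a, |f x| ≤ C
  zero_of_neg : ∀ x < 0, f x = 0

/-- Convolution of real functions on the line. -/
noncomputable def realConv (f g : ℝ → ℝ) : ℝ → ℝ :=
  f ⋆[ContinuousLinearMap.mul ℝ ℝ, volume] g

theorem realConv_apply (f g : ℝ → ℝ) (u : ℝ) :
    realConv f g u = ∫ t, f t * g (u - t) := rfl

theorem realConv_comm (f g : ℝ → ℝ) : realConv f g = realConv g f := by
  ext u
  rw [realConv_apply, realConv_apply, ← integral_sub_left_eq_self _ volume u]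
  exact integral_congr_ae (.of_forall fun t => by simp [mul_comm])

theorem realConv_shift (f g : ℝ → ℝ) (c u : ℝ) :
    realConv f (fun t => g (t - c)) u = realConv f g (u - c) := by
  simp only [realConv_apply]
  exact integral_congr_ae (.of_forall fun t => by
    show f t * g (u - t - c) = f t * g (u - c - t)
    ring_nf)

namespace CausalBdd

variable {f g k : ℝ → ℝ}

theorem add (hf : CausalBdd f) (hg : CausalBdd g) : CausalBdd (f + g) where
  measurable := hf.measurable.add hg.measurable
  bdd a := by
    obtain ⟨C, hC⟩ := hf.bdd a
    obtain ⟨D, hD⟩ := hg.bdd a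
    exact ⟨C + D, fun x hx => (abs_add_le _ _).trans (add_le_add (hC x hx) (hD x hx))⟩
  zero_of_neg x hx := by simp [hf.zero_of_neg x hx, hg.zero_of_neg x hx]

theorem neg (hf : CausalBdd f) : CausalBdd (-f) where
  measurable := hf.measurable.neg
  bdd a := by simpa using hf.bdd a
  zero_of_neg x hx := by simp [hf.zero_of_neg x hx]

theorem sub (hf : CausalBdd f) (hg : CausalBdd g) : CausalBdd (f - g) := by
  rw [sub_eq_add_neg]; exact hf.add hg.neg

theorem abs (hf : CausalBdd f) : CausalBdd (fun x => |f x|) where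
  measurable := by simpa using hf.measurable.norm
  bdd a := by simpa using hf.bdd a
  zero_of_neg x hx := by simp [hf.zero_of_neg x hx]

theorem const_mul (hf : CausalBdd f) (c : ℝ) : CausalBdd (fun x => c * f x) where
  measurable := hf.measurable.const_mul c
  bdd a := by
    obtain ⟨C, hC⟩ := hf.bdd a
    refine ⟨|c| * C, fun x hx => ?_⟩
    rw [abs_mul]
    exact mul_le_mul_of_nonneg_left (hC x hx) (abs_nonneg c)
  zero_of_neg x hx := by simp [hf.zero_of_neg x hx]

theorem id_mul (hf : CausalBdd f) : CausalBdd (fun x => x * f x) where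
  measurable := measurable_id.mul hf.measurable
  bdd a := by
    obtain ⟨C, hC⟩ := hf.bdd a
    refine ⟨|a| * |C|, fun x hx => ?_⟩
    rcases lt_or_ge x 0 with h | h
    · rw [hf.zero_of_neg x h]; simp; positivity
    · rw [abs_mul]
      refine mul_le_mul ?_ ((hC x hx).trans (le_abs_self C)) (abs_nonneg _) (abs_nonneg _)
      rw [abs_of_nonneg h]; exact hx.trans (le_abs_self a)
  zero_of_neg x hx := by simp [hf.zero_of_neg x hx]

theorem shift (hf : CausalBdd f) {c : ℝ} (hc : 0 ≤ c) : CausalBdd (fun x => f (x - c)) where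
  measurable := hf.measurable.comp (measurable_id.sub_const c)
  bdd a := by
    obtain ⟨C, hC⟩ := hf.bdd a
    exact ⟨C, fun x hx => hC _ (by linarith)⟩
  zero_of_neg x hx := hf.zero_of_neg _ (by linarith)

theorem exists_nonneg_bound (hf : CausalBdd f) (a : ℝ) : ∃ C, 0 ≤ C ∧ ∀ x ≤ a, |f x| ≤ C := by
  obtain ⟨C, hC⟩ := hf.bdd a
  exact ⟨C, (abs_nonneg _).trans (hC a le_rfl), hC⟩

/-- The singularity at `0` is harmless: the numerator vanishes for `x < 1`, and for `x ≥ 1` division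
only decreases the absolute value. -/
theorem shift_div (hf : CausalBdd f) : CausalBdd (fun x => f (x - 1) / x) where
  measurable := (hf.shift zero_le_one).measurable.div measurable_id
  bdd a := by
    obtain ⟨C, hC0, hC⟩ := (hf.shift zero_le_one).exists_nonneg_bound a
    refine ⟨C, fun x hx => ?_⟩
    rcases lt_or_ge x 1 with h | h
    · rw [hf.zero_of_neg _ (by linarith)]; simpa using hC0
    · rw [abs_div]
      exact (div_le_self (abs_nonneg _) (by rw [abs_of_nonneg] <;> linarith)).trans (hC x hx)
  zero_of_neg x hx := by simp [hf.zero_of_neg (x - 1) (by linarith)]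

theorem integrableOn_Icc (hf : CausalBdd f) (a b : ℝ) : IntegrableOn f (Set.Icc a b) := by
  obtain ⟨C, hC⟩ := hf.bdd b
  refine Measure.integrableOn_of_bounded (M := C) (by simp) hf.measurable.aestronglyMeasurable ?_
  exact (ae_restrict_mem measurableSet_Icc).mono fun x hx => hC x hx.2

theorem intervalIntegrable (hf : CausalBdd f) (a b : ℝ) : IntervalIntegrable f volume a b :=
  IntegrableOn.intervalIntegrable (hf.integrableOn_Icc (min a b) (max a b))

theorem conv_integrand_eq_zero (hf : CausalBdd f) (hg : CausalBdd g) {u t : ℝ}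
    (ht : t ∉ Set.Icc 0 u) : f t * g (u - t) = 0 := by
  rw [Set.mem_Icc, not_and_or, not_le, not_le] at ht
  rcases ht with h | h
  · simp [hf.zero_of_neg t h]
  · simp [hg.zero_of_neg (u - t) (by linarith)]

theorem exists_conv_integrand_bound (hf : CausalBdd f) (hg : CausalBdd g) (a : ℝ) :
    ∃ C, 0 ≤ C ∧ ∀ u ≤ a, ∀ t, |f t * g (u - t)| ≤ C := by
  obtain ⟨C, hC0, hC⟩ := hf.exists_nonneg_bound a
  obtain ⟨D, hD0, hD⟩ := hg.exists_nonneg_bound a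
  refine ⟨C * D, mul_nonneg hC0 hD0, fun u hu t => ?_⟩
  by_cases ht : t ∈ Set.Icc 0 u
  · rw [abs_mul]
    exact mul_le_mul (hC t (ht.2.trans hu)) (hD _ (by linarith [ht.1])) (abs_nonneg _) hC0
  · rw [conv_integrand_eq_zero hf hg ht]; simpa using mul_nonneg hC0 hD0

/-- The integrand is bounded and supported in the compact interval `[0, u]`, so no decay at infinity
is needed. -/
theorem convolutionExistsAt (hf : CausalBdd f) (hg : CausalBdd g) (u : ℝ) :
    ConvolutionExistsAt f g u (ContinuousLinearMap.mul ℝ ℝ) volume := by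
  obtain ⟨C, -, hC⟩ := exists_conv_integrand_bound hf hg u
  have hm : Measurable fun t => f t * g (u - t) :=
    hf.measurable.mul (hg.measurable.comp (measurable_const.sub measurable_id))
  have : IntegrableOn (fun t => f t * g (u - t)) (Set.Icc 0 u) :=
    Measure.integrableOn_of_bounded (M := C) (by simp) hm.aestronglyMeasurable
      (.of_forall fun t => hC u le_rfl t)
  exact this.integrable_of_forall_notMem_eq_zero fun t ht => conv_integrand_eq_zero hf hg ht

theorem realConv_eq_setIntegral (hf : CausalBdd f) (hg : CausalBdd g) (u : ℝ) :
    realConv f g u = ∫ t in Set.Icc 0 u, f t * g (u - t) := by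
  rw [realConv_apply, setIntegral_eq_integral_of_forall_compl_eq_zero]
  exact fun t ht => conv_integrand_eq_zero hf hg ht

theorem realConv_eq_intervalIntegral (hf : CausalBdd f) (hg : CausalBdd g) (u : ℝ) :
    realConv f g u = ∫ v in (0 : ℝ)..u, f (u - v) * g v := by
  rw [realConv_comm, realConv_eq_setIntegral hg hf]
  rcases le_or_gt 0 u with h | h
  · rw [intervalIntegral.integral_of_le h, integral_Icc_eq_integral_Ioc]
    simp only [mul_comm]
  · rw [intervalIntegral.integral_of_ge h.le, Set.Icc_eq_empty (by linarith)]
    rw [setIntegral_eq_zero_of_forall_eq_zero (t := Set.Ioc u 0)]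
    · simp
    · intro t ht
      rw [hf.zero_of_neg _ (by linarith [ht.1]), zero_mul]

theorem realConv (hf : CausalBdd f) (hg : CausalBdd g) : CausalBdd (realConv f g) where
  measurable := by
    have : StronglyMeasurable (fun p : ℝ × ℝ => f p.2 * g (p.1 - p.2)) :=
      ((hf.measurable.comp measurable_snd).mul
        (hg.measurable.comp (measurable_fst.sub measurable_snd))).stronglyMeasurable
    exact this.integral_prod_right'.measurable
  bdd a := by
    obtain ⟨C, hC0, hC⟩ := exists_conv_integrand_bound hf hg a
    refine ⟨C * |a|, fun u hu => ?_⟩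
    rw [realConv_eq_setIntegral hf hg]
    have h := norm_setIntegral_le_of_norm_le_const (μ := volume) (s := Set.Icc 0 u)
      (f := fun t => f t * g (u - t)) measure_Icc_lt_top fun t _ => hC u hu t
    refine h.trans (mul_le_mul_of_nonneg_left ?_ hC0)
    simpa using hu.trans (le_abs_self a)
  zero_of_neg u hu := by
    rw [realConv_eq_setIntegral hf hg, Set.Icc_eq_empty (by linarith)]; simp

theorem realConv_add (hf : CausalBdd f) (hg : CausalBdd g) (hk : CausalBdd k) :
    _root_.realConv f (g + k) = _root_.realConv f g + _root_.realConv f k := by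
  ext u
  exact (hf.convolutionExistsAt hg u).distrib_add (hf.convolutionExistsAt hk u)

theorem add_realConv (hf : CausalBdd f) (hg : CausalBdd g) (hk : CausalBdd k) :
    _root_.realConv (f + g) k = _root_.realConv f k + _root_.realConv g k := by
  ext u
  exact (hf.convolutionExistsAt hk u).add_distrib (hg.convolutionExistsAt hk u)

theorem neg_realConv (f g : ℝ → ℝ) : _root_.realConv (-f) g = -_root_.realConv f g := by
  ext u
  simp [realConv_apply, integral_neg]

theorem sub_realConv (hf : CausalBdd f) (hg : CausalBdd g) (hk : CausalBdd k) :
    _root_.realConv (f - g) k = _root_.realConv f k - _root_.realConv g k := by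
  rw [sub_eq_add_neg, add_realConv hf hg.neg hk, neg_realConv, ← sub_eq_add_neg]

theorem realConv_assoc (hf : CausalBdd f) (hg : CausalBdd g) (hk : CausalBdd k) :
    _root_.realConv (_root_.realConv f g) k = _root_.realConv f (_root_.realConv g k) := by
  ext u
  exact convolution_assoc _ _ _ _ (fun x y z => by simp [mul_assoc])
    hf.measurable.aestronglyMeasurable hg.measurable.aestronglyMeasurable
    hk.measurable.aestronglyMeasurable (.of_forall fun y => hf.convolutionExistsAt hg y)
    (.of_forall fun y => hg.abs.convolutionExistsAt hk.abs y)
    (hf.abs.convolutionExistsAt (hg.abs.realConv hk.abs) u)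

/-- Multiplication by the variable is a derivation for convolution. -/
theorem id_mul_realConv (hf : CausalBdd f) (hg : CausalBdd g) (u : ℝ) :
    u * _root_.realConv f g u =
      _root_.realConv (fun t => t * f t) g u + _root_.realConv f (fun t => t * g t) u := by
  have h1 : Integrable fun t => t * f t * g (u - t) := hf.id_mul.convolutionExistsAt hg u
  have h2 : Integrable fun t => f t * ((u - t) * g (u - t)) := hf.convolutionExistsAt hg.id_mul u
  simp only [realConv_apply]
  rw [← integral_add h1 h2, ← integral_const_mul]
  exact integral_congr_ae (.of_forall fun t => by ring)

end CausalBdd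

/-! ### `ρ`, `ρ'` and `ω` as causal functions, and their functional equations. -/

/-- The indicator function of the half-line `[0, ∞)`. -/
noncomputable def heaviside (u : ℝ) : ℝ := if 0 ≤ u then 1 else 0

theorem heaviside_causalBdd : CausalBdd heaviside where
  measurable := Measurable.ite measurableSet_Ici measurable_const measurable_const
  bdd a := ⟨1, fun x _ => by unfold heaviside; split_ifs <;> simp⟩
  zero_of_neg x hx := by simp [heaviside, hx]

theorem heaviside_realConv {f : ℝ → ℝ} (hf : CausalBdd f) (u : ℝ) :
    realConv heaviside f u = ∫ v in (0 : ℝ)..u, f v := by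
  rw [heaviside_causalBdd.realConv_eq_intervalIntegral hf]
  rcases le_or_gt 0 u with h | h
  · refine intervalIntegral.integral_congr fun v hv => ?_
    rw [Set.uIcc_of_le h] at hv
    simp [heaviside, hv.2]
  -- For `u < 0` the only point of `(u, 0]` where `f` can be nonzero is `0`, a null set.
  · refine intervalIntegral.integral_congr_ae ?_
    have h0 : ∀ᵐ v : ℝ, v ≠ 0 := by simp [ae_iff]
    filter_upwards [h0] with v h0 hv
    rw [Set.uIoc_of_ge h.le] at hv
    simp [hf.zero_of_neg v (lt_of_le_of_ne hv.2 h0)]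

theorem CausalBdd.of_abs_le_continuous {f G : ℝ → ℝ} (hf : Measurable f) (hG : Continuous G)
    (h0 : ∀ x < 0, f x = 0) (hfG : ∀ x, 0 ≤ x → |f x| ≤ G x) : CausalBdd f where
  measurable := hf
  bdd a := by
    obtain ⟨C, hC⟩ := (isCompact_Icc (a := 0) (b := a)).exists_bound_of_continuousOn hG.continuousOn
    refine ⟨|C|, fun x hx => ?_⟩
    rcases lt_or_ge x 0 with h | h
    · rw [h0 x h]; simp
    · exact (hfG x h).trans ((le_abs_self _).trans ((hC x ⟨h, hx⟩).trans (le_abs_self C)))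
  zero_of_neg := h0

theorem CausalBdd.continuous_primitive {f : ℝ → ℝ} (hf : CausalBdd f) (a : ℝ) :
    Continuous fun u => ∫ t in a..u, f t :=
  intervalIntegral.continuous_primitive (fun a b => hf.intervalIntegrable a b) a

/-- A pointwise eventually constant limit of causal functions is causal. -/
theorem CausalBdd.of_stage {F : ℕ → ℝ → ℝ} {f : ℝ → ℝ} (hF : ∀ n, CausalBdd (F n))
    (h : ∀ (n : ℕ) (u : ℝ), u ≤ n → f u = F n u) : CausalBdd f where
  measurable := by
    refine measurable_of_tendsto_metrizable (fun n => (hF n).measurable) ?_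
    rw [tendsto_pi_nhds]
    intro u
    obtain ⟨N, hN⟩ := exists_nat_ge u
    refine tendsto_const_nhds.congr' ?_
    filter_upwards [Filter.eventually_ge_atTop N] with n hn
    exact h n u (hN.trans (by exact_mod_cast hn))
  bdd a := by
    obtain ⟨N, hN⟩ := exists_nat_ge a
    obtain ⟨C, hC⟩ := (hF N).bdd a
    exact ⟨C, fun x hx => by rw [h N x (hx.trans hN)]; exact hC x hx⟩
  zero_of_neg x hx := by
    rw [h 0 x (by simpa using hx.le)]; exact (hF 0).zero_of_neg x hx

theorem dickmanStage_causalBdd (n : ℕ) : CausalBdd (dickmanStage n) := by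
  induction n with
  | zero =>
    refine .of_abs_le_continuous (G := fun _ => 1) ?_ continuous_const ?_ ?_
    · exact Measurable.ite measurableSet_Iio measurable_const measurable_const
    · intro x hx; simp [dickmanStage, hx]
    · intro x hx; simp [dickmanStage, not_lt.mpr hx]
  | succ n ih =>
    have hc := ih.shift_div.continuous_primitive 1
    refine .of_abs_le_continuous
      (G := fun u => 1 + |1 - ∫ t in (1 : ℝ)..u, dickmanStage n (t - 1) / t|) ?_ (by fun_prop) ?_ ?_
    · exact Measurable.ite measurableSet_Iio measurable_const
        (Measurable.ite measurableSet_Iic measurable_const (measurable_const.sub hc.measurable))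
    · intro x hx; simp [dickmanStage, hx]
    · intro x hx
      simp only [dickmanStage, not_lt.mpr hx, if_false]
      split_ifs
      · simp
      · linarith [abs_nonneg (1 - ∫ t in (1 : ℝ)..x, dickmanStage n (t - 1) / t)]

theorem dickmanRho_causalBdd : CausalBdd dickmanRho :=
  .of_stage dickmanStage_causalBdd fun n u hu => dickmanRho_eq_stage n u (by linarith)

theorem buchstabStage_causalBdd (n : ℕ) : CausalBdd (buchstabStage n) := by
  induction n with
  | zero =>
    refine .of_abs_le_continuous (G := fun _ => 1) ?_ continuous_const ?_ ?_
    · exact Measurable.ite measurableSet_Iio measurable_const (measurable_const.div measurable_id)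
    · intro x hx; simp [buchstabStage, hx.trans one_pos]
    · intro x hx
      simp only [buchstabStage]
      split_ifs with h
      · simp
      · rw [abs_of_nonneg (by positivity), div_le_one (by linarith)]; linarith
  | succ n ih =>
    have hc : Continuous fun u => ∫ t in (1 : ℝ)..(u - 1), buchstabStage n t :=
      (ih.continuous_primitive 1).comp (continuous_id.sub continuous_const)
    refine .of_abs_le_continuous
      (G := fun u => 1 + |1 + ∫ t in (1 : ℝ)..(u - 1), buchstabStage n t|) ?_ (by fun_prop) ?_ ?_
    · exact Measurable.ite measurableSet_Iio measurable_const
        (Measurable.ite measurableSet_Iic (measurable_const.div measurable_id)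
          ((measurable_const.add hc.measurable).div measurable_id))
    · intro x hx; simp [buchstabStage, hx.trans one_pos]
    · intro x hx
      have := abs_nonneg (1 + ∫ t in (1 : ℝ)..(x - 1), buchstabStage n t)
      simp only [buchstabStage]
      split_ifs with h h2
      · simp only [abs_zero]; linarith
      · rw [abs_of_nonneg (by positivity)]
        have : 1 / x ≤ 1 := by rw [div_le_one (by linarith)]; linarith
        linarith
      · rw [abs_div, abs_of_nonneg hx]
        have := div_le_self this (show (1 : ℝ) ≤ x by linarith)
        linarith

theorem buchstabOmega_causalBdd : CausalBdd buchstabOmega :=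
  .of_stage buchstabStage_causalBdd fun n u hu => buchstabOmega_eq_stage n u (by linarith)

theorem buchstabStage_nonneg (n : ℕ) (u : ℝ) : 0 ≤ buchstabStage n u := by
  induction n generalizing u with
  | zero =>
    simp only [buchstabStage]
    split_ifs with h
    · exact le_rfl
    · rw [not_lt] at h; positivity
  | succ n ih =>
    simp only [buchstabStage]
    split_ifs with h h2
    · exact le_rfl
    · rw [not_lt] at h; positivity
    · have : 0 ≤ ∫ t in (1 : ℝ)..(u - 1), buchstabStage n t :=
        intervalIntegral.integral_nonneg (by linarith) fun t _ => ih t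
      have : 0 ≤ u := by linarith
      positivity

theorem buchstabOmega_nonneg (u : ℝ) : 0 ≤ buchstabOmega u := buchstabStage_nonneg _ _

/-- The integrand vanishes almost everywhere on `[0, 1]`, so starting the integral at `0` merges the
two regimes of the definition. -/
theorem dickmanRho_eq_one_sub_integral {u : ℝ} (hu : 0 ≤ u) :
    dickmanRho u = 1 - ∫ t in (0 : ℝ)..u, dickmanRho (t - 1) / t := by
  have h01 : ∀ v ≤ 1, 0 ≤ v → ∫ t in (0 : ℝ)..v, dickmanRho (t - 1) / t = 0 := by
    intro v hv hv0
    refine intervalIntegral.integral_zero_ae ?_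
    have h1 : ∀ᵐ t : ℝ, t ≠ 1 := by simp [ae_iff]
    filter_upwards [h1] with t ht htv
    rw [Set.uIoc_of_le hv0] at htv
    have : t < 1 := lt_of_le_of_ne (htv.2.trans hv) ht
    rw [dickmanRho_of_neg _ (by linarith), zero_div]
  rcases le_or_gt u 1 with h | h
  · rw [dickmanRho_of_le_one u hu h, h01 u h hu, sub_zero]
  · rw [dickmanRho_of_one_lt u h]
    have hI := dickmanRho_causalBdd.shift_div.intervalIntegrable
    rw [← intervalIntegral.integral_add_adjacent_intervals (hI 0 1) (hI 1 u),
      h01 1 le_rfl zero_le_one, zero_add]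

theorem continuousOn_dickmanRho : ContinuousOn dickmanRho (Set.Ici 0) :=
  (continuous_const.sub (dickmanRho_causalBdd.shift_div.continuous_primitive 0)).continuousOn.congr
    fun _ hu => dickmanRho_eq_one_sub_integral hu

/-- For `u < 1`, `ρ` is constant to the right of `u` and `ρ(u - 1) = 0`; this includes `u = 0`,
where the quotient is `0 / 0 = 0`. For `u ≥ 1` it is the one-sided fundamental theorem of calculus.
-/
theorem dickmanRhoDeriv_eq (u : ℝ) : dickmanRhoDeriv u = -(dickmanRho (u - 1) / u) := by
  unfold dickmanRhoDeriv
  have huniq := uniqueDiffOn_Ici u u Set.self_mem_Ici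
  have hconst : ∀ c, dickmanRho =ᶠ[nhdsWithin u (Set.Ici u)] (fun _ => c) → u < 1 →
      derivWithin dickmanRho (Set.Ici u) u = -(dickmanRho (u - 1) / u) := by
    intro c hc hu
    rw [hc.derivWithin_eq (hc.self_of_nhdsWithin Set.self_mem_Ici), derivWithin_fun_const,
      dickmanRho_of_neg _ (by linarith)]
    simp
  rcases lt_or_ge u 0 with h0 | h0
  · refine hconst 0 ?_ (h0.trans one_pos)
    filter_upwards [mem_nhdsWithin_of_mem_nhds (Iio_mem_nhds h0)] with v hv
    exact dickmanRho_of_neg v hv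
  rcases lt_or_ge u 1 with h1 | h1
  · refine hconst 1 ?_ h1
    filter_upwards [mem_nhdsWithin_of_mem_nhds (Iio_mem_nhds h1), self_mem_nhdsWithin] with v hv hv'
    exact dickmanRho_of_le_one v (h0.trans hv') hv.le
  have hS := dickmanRho_causalBdd.shift_div
  -- Only right-continuity is available at `u = 1`, because `ρ` jumps at `0`; for `t ≥ u ≥ 1` the
  -- argument `t - 1` stays in `[0, ∞)`.
  have hcont : ContinuousWithinAt (fun t => dickmanRho (t - 1) / t) (Set.Ici u) u := by
    refine ContinuousWithinAt.div ?_ continuousWithinAt_id (by linarith)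
    refine ContinuousWithinAt.comp (f := fun t : ℝ => t - 1) (t := Set.Ici 0)
      (continuousOn_dickmanRho (u - 1) (by simpa using h1))
      (by fun_prop) fun v hv => ?_
    have : u ≤ v := hv
    simp; linarith
  have hd := (intervalIntegral.integral_hasDerivWithinAt_right (hS.intervalIntegrable 0 u)
    (s := Set.Ici u) (t := Set.Ioi u)
    (hS.measurable.stronglyMeasurable.stronglyMeasurableAtFilter)
    (hcont.mono Set.Ioi_subset_Ici_self)).const_sub 1
  refine (hd.congr (fun v hv => ?_) (dickmanRho_eq_one_sub_integral h0)).derivWithin huniq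
  exact dickmanRho_eq_one_sub_integral (h0.trans hv)

theorem dickmanRhoDeriv_causalBdd : CausalBdd dickmanRhoDeriv := by
  have h := dickmanRho_causalBdd.shift_div.neg
  have e : dickmanRhoDeriv = -fun x => dickmanRho (x - 1) / x := funext dickmanRhoDeriv_eq
  rwa [← e] at h

theorem dickmanRho_eq_heaviside_add :
    dickmanRho = heaviside + realConv heaviside dickmanRhoDeriv := by
  ext u
  rcases lt_or_ge u 0 with h | h
  · rw [dickmanRho_of_neg u h]
    exact ((heaviside_causalBdd.add
      (heaviside_causalBdd.realConv dickmanRhoDeriv_causalBdd)).zero_of_neg u h).symm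
  · rw [Pi.add_apply, heaviside_realConv dickmanRhoDeriv_causalBdd,
      dickmanRho_eq_one_sub_integral h]
    simp [heaviside, h, dickmanRhoDeriv_eq, sub_eq_add_neg]

theorem id_mul_dickmanRhoDeriv (u : ℝ) : u * dickmanRhoDeriv u = (-dickmanRho) (u - 1) := by
  rw [dickmanRhoDeriv_eq, Pi.neg_apply]
  rcases eq_or_ne u 0 with rfl | h
  · simp [dickmanRho_of_neg (-1) (by norm_num)]
  · field_simp

/-- Integrating `ω` from `0` rather than `1` changes nothing, and the integral vanishes for `u ≤ 2`,
so one formula covers all three ranges of the definition. -/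
theorem id_mul_buchstabOmega (u : ℝ) :
    u * buchstabOmega u = (heaviside + realConv heaviside buchstabOmega) (u - 1) := by
  have hω := buchstabOmega_causalBdd
  rcases lt_or_ge u 1 with h | h
  · rw [(heaviside_causalBdd.add (heaviside_causalBdd.realConv hω)).zero_of_neg _ (by linarith),
      buchstabOmega_of_lt_one u h, mul_zero]
  have h01 : ∀ v ≤ 1, 0 ≤ v → ∫ t in (0 : ℝ)..v, buchstabOmega t = 0 := by
    intro v hv hv0
    refine intervalIntegral.integral_zero_ae ?_
    have h1 : ∀ᵐ t : ℝ, t ≠ 1 := by simp [ae_iff]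
    filter_upwards [h1] with t ht htv
    rw [Set.uIoc_of_le hv0] at htv
    exact buchstabOmega_of_lt_one t (lt_of_le_of_ne (htv.2.trans hv) ht)
  have hu : u ≠ 0 := by linarith
  rw [Pi.add_apply, heaviside_realConv hω, heaviside, if_pos (by linarith)]
  rcases le_or_gt u 2 with h2 | h2
  · rw [buchstabOmega_of_le_two u h h2, h01 _ (by linarith) (by linarith)]
    field_simp; simp
  · have hI := hω.intervalIntegrable
    rw [buchstabOmega_of_two_lt u h2,
      ← intervalIntegral.integral_add_adjacent_intervals (hI 0 1) (hI 1 (u - 1)),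
      h01 1 le_rfl zero_le_one]
    field_simp; simp

/-! ### `δ₀ + ω` and `δ₀ + ρ'` as convolution inverses. -/

/-- The convolution identity `ω + ρ' + ρ' * ω = 0`. -/
theorem buchstabOmega_add_dickmanRhoDeriv_add_conv :
    buchstabOmega + dickmanRhoDeriv + realConv dickmanRhoDeriv buchstabOmega = 0 := by
  have hω := buchstabOmega_causalBdd
  have hd := dickmanRhoDeriv_causalBdd
  have hH := heaviside_causalBdd
  -- Multiplying the identity by `u` as a derivation, and using the equations for `u ρ'(u)` and `u
  -- ω(u)`, turns it into this expression at `u - 1`. It vanishes because `ρ = H + H * ρ'`.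
  have key : -dickmanRho - realConv dickmanRho buchstabOmega + (heaviside +
      realConv heaviside buchstabOmega) + realConv dickmanRhoDeriv (heaviside +
      realConv heaviside buchstabOmega) = 0 := by
    have e : realConv dickmanRho buchstabOmega = realConv heaviside buchstabOmega +
        realConv dickmanRhoDeriv (realConv heaviside buchstabOmega) := by
      conv_lhs => rw [dickmanRho_eq_heaviside_add]
      rw [hH.add_realConv (hH.realConv hd) hω, realConv_comm heaviside dickmanRhoDeriv,
        hd.realConv_assoc hH hω]
    rw [e, hd.realConv_add hH (hH.realConv hω), realConv_comm dickmanRhoDeriv heaviside]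
    conv_lhs => rw [dickmanRho_eq_heaviside_add]
    abel
  ext u
  -- Division by `u` loses the point `0`, where each term is zero on its own.
  rcases eq_or_ne u 0 with rfl | hu
  · have : realConv dickmanRhoDeriv buchstabOmega 0 = 0 := by
      rw [hd.realConv_eq_intervalIntegral hω]; simp
    simp [this, buchstabOmega_of_lt_one 0 one_pos, dickmanRhoDeriv_eq]
  · have h := congrFun key (u - 1)
    have e1 : (fun t => t * dickmanRhoDeriv t) = fun t => (-dickmanRho) (t - 1) :=
      funext id_mul_dickmanRhoDeriv
    have e2 : (fun t => t * buchstabOmega t) =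
        fun t => (heaviside + realConv heaviside buchstabOmega) (t - 1) :=
      funext id_mul_buchstabOmega
    have hmul := hd.id_mul_realConv hω u
    rw [e1, e2, realConv_shift, realConv_comm (fun t => (-dickmanRho) (t - 1)),
      realConv_shift, realConv_comm buchstabOmega (-dickmanRho),
      CausalBdd.neg_realConv] at hmul
    have h1 := id_mul_dickmanRhoDeriv u
    have h2 := id_mul_buchstabOmega u
    refine (mul_eq_zero.mp (?_ : u * _ = 0)).resolve_left hu
    simp only [Pi.add_apply, Pi.sub_apply, Pi.neg_apply, Pi.zero_apply] at *
    linear_combination h + hmul + h1 + h2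

/-- If `f = a + ρ' * a` then `f + f * ω = a`. -/
theorem add_conv_buchstabOmega {a : ℝ → ℝ} (ha : CausalBdd a) :
    (a + realConv a dickmanRhoDeriv) +
      realConv (a + realConv a dickmanRhoDeriv) buchstabOmega = a := by
  have hω := buchstabOmega_causalBdd
  have hd := dickmanRhoDeriv_causalBdd
  have h0 : realConv a (buchstabOmega + dickmanRhoDeriv +
      realConv dickmanRhoDeriv buchstabOmega) = 0 := by
    rw [buchstabOmega_add_dickmanRhoDeriv_add_conv]
    ext u; simp [realConv_apply]
  rw [ha.realConv_add (hω.add hd) (hd.realConv hω), ha.realConv_add hω hd] at h0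
  rw [ha.add_realConv (ha.realConv hd) hω, ha.realConv_assoc hd hω]
  rw [add_assoc, show realConv a dickmanRhoDeriv + (realConv a buchstabOmega +
    realConv a (realConv dickmanRhoDeriv buchstabOmega)) = 0 by rw [← h0]; abel, add_zero]

/-- `ρ + ρ * ω = 1` on `[0, ∞)`. -/
theorem dickmanRho_add_conv_buchstabOmega :
    dickmanRho + realConv dickmanRho buchstabOmega = heaviside := by
  have h := add_conv_buchstabOmega heaviside_causalBdd
  rwa [← dickmanRho_eq_heaviside_add] at h

/-! ### Smooth and rough integers, and unique factorization into the two. -/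

open Classical in
/-- The `y`-smooth integers in `[1, N]`. -/
noncomputable def smoothUpTo (y : ℝ) (N : ℕ) : Finset ℕ :=
  (Finset.Icc 1 N).filter (· ∈ smoothSet y)

open Classical in
/-- The `y`-rough integers in `[1, N]`. -/
noncomputable def roughUpTo (y : ℝ) (N : ℕ) : Finset ℕ :=
  (Finset.Icc 1 N).filter (· ∈ roughSet y)

theorem mem_smoothUpTo {y : ℝ} {N n : ℕ} :
    n ∈ smoothUpTo y N ↔ n ∈ smoothSet y ∧ n ≤ N := by
  simp only [smoothUpTo, Finset.mem_filter, Finset.mem_Icc]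
  exact ⟨fun h => ⟨h.2, h.1.2⟩, fun h => ⟨⟨h.1.1, h.2⟩, h.1⟩⟩

theorem mem_roughUpTo {y : ℝ} {N n : ℕ} :
    n ∈ roughUpTo y N ↔ n ∈ roughSet y ∧ n ≤ N := by
  simp only [roughUpTo, Finset.mem_filter, Finset.mem_Icc]
  exact ⟨fun h => ⟨h.2, h.1.2⟩, fun h => ⟨⟨h.1.1, h.2⟩, h.1⟩⟩

theorem smoothCount_eq_card {x : ℝ} (hx : 0 ≤ x) (y : ℝ) :
    smoothCount x y = (smoothUpTo y ⌊x⌋₊).card := by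
  rw [smoothCount, ← Set.ncard_coe_finset]
  congr 2
  ext n
  simp [mem_smoothUpTo, Nat.le_floor_iff hx]

theorem roughCount_eq_card {x : ℝ} (hx : 0 ≤ x) (y : ℝ) :
    roughCount x y = (roughUpTo y ⌊x⌋₊).card := by
  rw [roughCount, ← Set.ncard_coe_finset]
  congr 2
  ext n
  simp [mem_roughUpTo, Nat.le_floor_iff hx]

theorem one_mem_smoothSet (y : ℝ) : 1 ∈ smoothSet y :=
  ⟨le_rfl, fun _ hp h => absurd (Nat.dvd_one.mp h) hp.ne_one⟩

theorem one_mem_roughSet (y : ℝ) : 1 ∈ roughSet y :=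
  ⟨le_rfl, fun _ hp h => absurd (Nat.dvd_one.mp h) hp.ne_one⟩

theorem mul_mem_smoothSet {y : ℝ} {m n : ℕ} (hm : m ∈ smoothSet y) (hn : n ∈ smoothSet y) :
    m * n ∈ smoothSet y :=
  ⟨Nat.mul_pos hm.1 hn.1, fun p hp h => (hp.dvd_mul.mp h).elim (hm.2 p hp) (hn.2 p hp)⟩

theorem mul_mem_roughSet {y : ℝ} {m n : ℕ} (hm : m ∈ roughSet y) (hn : n ∈ roughSet y) :
    m * n ∈ roughSet y :=
  ⟨Nat.mul_pos hm.1 hn.1, fun p hp h => (hp.dvd_mul.mp h).elim (hm.2 p hp) (hn.2 p hp)⟩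

theorem mem_smoothSet_of_dvd {y : ℝ} {m n : ℕ} (hn : n ∈ smoothSet y) (h : m ∣ n) :
    m ∈ smoothSet y :=
  ⟨Nat.pos_of_dvd_of_pos h hn.1, fun p hp hpm => hn.2 p hp (hpm.trans h)⟩

theorem coprime_of_mem_smoothSet_of_mem_roughSet {y : ℝ} {m n : ℕ} (hm : m ∈ smoothSet y)
    (hn : n ∈ roughSet y) : m.Coprime n :=
  Nat.coprime_of_dvd fun p hp h1 h2 => (hm.2 p hp h1).not_gt (hn.2 p hp h2)

theorem exists_smooth_mul_rough (y : ℝ) (m : ℕ) (hm : 1 ≤ m) :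
    ∃ n ∈ smoothSet y, ∃ k ∈ roughSet y, n * k = m := by
  induction m using Nat.recOnMul with
  | zero => omega
  | one => exact ⟨1, one_mem_smoothSet y, 1, one_mem_roughSet y, rfl⟩
  | prime p hp =>
    rcases le_or_gt (p : ℝ) y with h | h
    · refine ⟨p, ⟨hp.one_le, fun q hq hd => ?_⟩, 1, one_mem_roughSet y, mul_one p⟩
      rwa [(Nat.prime_dvd_prime_iff_eq hq hp).mp hd]
    · refine ⟨1, one_mem_smoothSet y, p, ⟨hp.one_le, fun q hq hd => ?_⟩, one_mul p⟩
      rwa [(Nat.prime_dvd_prime_iff_eq hq hp).mp hd]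
  | mul a b iha ihb =>
    obtain ⟨n, hn, k, hk, rfl⟩ := iha (Nat.pos_of_mul_pos_right hm)
    obtain ⟨n', hn', k', hk', rfl⟩ := ihb (Nat.pos_of_mul_pos_left hm)
    exact ⟨n * n', mul_mem_smoothSet hn hn', k * k', mul_mem_roughSet hk hk', by ring⟩

/-- A smooth number is coprime to a rough one, so each smooth factor divides the other. -/
theorem smooth_mul_rough_injective {y : ℝ} {n k n' k' : ℕ} (hn : n ∈ smoothSet y)
    (hk : k ∈ roughSet y) (hn' : n' ∈ smoothSet y) (hk' : k' ∈ roughSet y)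
    (h : n * k = n' * k') : n = n' ∧ k = k' := by
  have h1 : n ∣ n' := (coprime_of_mem_smoothSet_of_mem_roughSet hn hk').dvd_of_dvd_mul_right
    (h ▸ dvd_mul_right n k)
  have h2 : n' ∣ n := (coprime_of_mem_smoothSet_of_mem_roughSet hn' hk).dvd_of_dvd_mul_right
    (h ▸ dvd_mul_right n' k')
  obtain rfl := Nat.dvd_antisymm h1 h2
  exact ⟨rfl, Nat.eq_of_mul_eq_mul_left hn.1 h⟩

/-- Every positive integer is uniquely the product of a smooth and a rough number. -/
theorem sum_card_roughUpTo (y : ℝ) (N : ℕ) :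
    ∑ n ∈ smoothUpTo y N, (roughUpTo y (N / n)).card = N := by
  rw [← Finset.card_sigma]
  conv_rhs => rw [← Nat.add_sub_cancel N 1, ← Nat.card_Icc]
  refine Finset.card_bij (fun a _ => a.1 * a.2) ?_ ?_ ?_
  · rintro ⟨n, k⟩ h
    simp only [Finset.mem_sigma, mem_smoothUpTo, mem_roughUpTo] at h
    rw [Finset.mem_Icc]
    refine ⟨Nat.mul_pos h.1.1.1 h.2.1.1, ?_⟩
    rw [mul_comm]
    exact (Nat.le_div_iff_mul_le h.1.1.1).mp h.2.2
  · rintro ⟨n, k⟩ h ⟨n', k'⟩ h' he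
    simp only [Finset.mem_sigma, mem_smoothUpTo, mem_roughUpTo] at h h'
    obtain ⟨rfl, rfl⟩ := smooth_mul_rough_injective h.1.1 h.2.1 h'.1.1 h'.2.1 he
    rfl
  · intro m hm
    rw [Finset.mem_Icc] at hm
    obtain ⟨n, hn, k, hk, rfl⟩ := exists_smooth_mul_rough y m hm.1
    refine ⟨⟨n, k⟩, ?_, rfl⟩
    simp only [Finset.mem_sigma, mem_smoothUpTo, mem_roughUpTo]
    exact ⟨⟨hn, (Nat.le_mul_of_pos_right n hk.1).trans hm.2⟩, hk,
      (Nat.le_div_iff_mul_le hn.1).mpr (by rw [mul_comm]; exact hm.2)⟩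

theorem sum_roughCount {x : ℝ} (hx : 0 ≤ x) (y : ℝ) :
    ∑ n ∈ smoothUpTo y ⌊x⌋₊, roughCount (x / n) y = ⌊x⌋₊ := by
  conv_rhs => rw [← sum_card_roughUpTo y ⌊x⌋₊]
  push_cast
  refine Finset.sum_congr rfl fun n _ => ?_
  rw [roughCount_eq_card (by positivity), Nat.floor_div_natCast]

/-! ### `R*` as a finite sum. -/

theorem muY_of_neg (y : ℝ) {u : ℝ} (hu : u < 0) : muY y u = 0 := by
  unfold muY
  rw [intervalIntegral.integral_congr (g := fun _ => 0), intervalIntegral.integral_zero]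
  intro v hv
  rw [Set.uIcc_of_ge hu.le] at hv
  simp [buchstabOmega_of_lt_one (u - v) (by linarith [hv.1])]

theorem QStar_eq_zero {x y : ℝ} (hy : 2 ≤ y) (h0 : 0 < x) (h1 : x < 1) : QStar x y = 0 := by
  have hu : logRatio x y < 0 := div_neg_of_neg_of_pos (Real.log_neg h0 h1)
    (Real.log_pos (by linarith))
  have : roughUpTo y 0 = ∅ := by simp [roughUpTo]
  rw [QStar, VStar, muY_of_neg y hu, roughCount_eq_card h0.le, Nat.floor_eq_zero.mpr h1, this]
  simp [h1]

theorem RStar_eq_sum {x y : ℝ} (hy : 2 ≤ y) (hx : 0 < x) :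
    RStar x y = ∑ n ∈ smoothUpTo y ⌊x⌋₊, QStar (x / n) y := by
  rw [RStar, tsum_subtype (smoothSet y) (fun n : ℕ => QStar (x / n) y),
    tsum_eq_sum (s := smoothUpTo y ⌊x⌋₊)]
  · refine Finset.sum_congr rfl fun n hn => ?_
    rw [Set.indicator_of_mem (mem_smoothUpTo.mp hn).1]
  · intro n hn
    by_cases h : n ∈ smoothSet y
    · rw [Set.indicator_of_mem h]
      have hn0 : (0 : ℝ) < n := by exact_mod_cast h.1
      have hnx : ⌊x⌋₊ < n := by
        by_contra hc
        exact hn (mem_smoothUpTo.mpr ⟨h, not_lt.mp hc⟩)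
      refine QStar_eq_zero hy (by positivity) ?_
      rw [div_lt_one hn0]
      exact (Nat.floor_lt hx.le).mp hnx
    · rw [Set.indicator_of_notMem h]

/-! ### Passage to the logarithmic variable. -/

/-- The function `v ↦ y^{-v}` on `[0, ∞)`. -/
noncomputable def rpowDecay (y v : ℝ) : ℝ := heaviside v * y ^ (-v)

/-- The function `v ↦ {y^v} / y^v` on `[0, ∞)`. -/
noncomputable def fractRatio (y v : ℝ) : ℝ := heaviside v * (Int.fract (y ^ v) / y ^ v)

theorem rpowDecay_causalBdd {y : ℝ} (hy : 2 ≤ y) : CausalBdd (rpowDecay y) := by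
  have hc : Continuous fun v : ℝ => y ^ (-v) :=
    continuous_const.rpow continuous_neg fun _ => .inl (by linarith)
  refine .of_abs_le_continuous (heaviside_causalBdd.measurable.mul hc.measurable) hc ?_ ?_
  · intro v hv; simp [rpowDecay, heaviside, hv]
  · intro v hv
    have : 0 < y ^ (-v) := Real.rpow_pos_of_pos (by linarith) _
    simp [rpowDecay, heaviside, hv, abs_of_pos this]

theorem fractRatio_causalBdd {y : ℝ} (hy : 2 ≤ y) : CausalBdd (fractRatio y) := by
  have hc : Continuous fun v : ℝ => y ^ v :=
    continuous_const.rpow continuous_id fun _ => .inl (by linarith)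
  refine .of_abs_le_continuous (G := fun _ => 1)
    (heaviside_causalBdd.measurable.mul (hc.measurable.fract.div hc.measurable))
    continuous_const ?_ ?_
  · intro v hv; simp [fractRatio, heaviside, hv]
  · intro v hv
    have h1 : 1 ≤ y ^ v := Real.one_le_rpow (by linarith) hv
    have h2 := Int.fract_nonneg (y ^ v)
    have h3 := Int.fract_lt_one (y ^ v)
    simp only [fractRatio, heaviside, hv, if_true, one_mul]
    rw [abs_of_nonneg (by positivity), div_le_one (by linarith)]
    linarith

theorem muY_eq_realConv {y : ℝ} (hy : 2 ≤ y) (u : ℝ) :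
    muY y u = realConv buchstabOmega (rpowDecay y) u := by
  have hc := buchstabOmega_causalBdd.realConv (rpowDecay_causalBdd hy)
  rcases lt_or_ge u 0 with h | h
  · rw [muY_of_neg y h, hc.zero_of_neg u h]
  · rw [buchstabOmega_causalBdd.realConv_eq_intervalIntegral (rpowDecay_causalBdd hy), muY]
    refine intervalIntegral.integral_congr fun v hv => ?_
    rw [Set.uIcc_of_le h] at hv
    simp [rpowDecay, heaviside, hv.1]

theorem logRatio_rpow {y : ℝ} (hy : 2 ≤ y) (v : ℝ) : logRatio (y ^ v) y = v := by
  rw [logRatio, Real.log_rpow (by linarith)]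
  have := Real.log_pos (show 1 < y by linarith)
  field_simp

theorem rpow_logRatio {x y : ℝ} (hy : 2 ≤ y) (hx : 0 < x) : y ^ logRatio x y = x := by
  have := Real.log_pos (show 1 < y by linarith)
  rw [Real.rpow_def_of_pos (by linarith), logRatio, mul_div_cancel₀ _ this.ne', Real.exp_log hx]

/-- The term `1_{x ≥ 1}` of `V*` is `x` times `rpowDecay`, so `V* / x` is `δ₀ + ω` convolved with
`rpowDecay`. -/
theorem VStar_rpow {y : ℝ} (hy : 2 ≤ y) (w : ℝ) :
    VStar (y ^ w) y =
      y ^ w * (rpowDecay y w + realConv buchstabOmega (rpowDecay y) w) := by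
  have h0 : 0 < y ^ w := Real.rpow_pos_of_pos (by linarith) _
  rw [VStar, logRatio_rpow hy, muY_eq_realConv hy, mul_add]
  congr 1
  have hi : 1 ≤ y ^ w ↔ 0 ≤ w := by
    conv_lhs => rw [← Real.rpow_zero y]
    exact Real.rpow_le_rpow_left_iff (by linarith)
  by_cases hw : 0 ≤ w
  · rw [Set.indicator_of_mem (Set.mem_Ici.mpr (hi.mpr hw)), rpowDecay, heaviside, if_pos hw,
      Real.rpow_neg (by linarith)]
    field_simp; simp
  · rw [Set.indicator_of_notMem (mt Set.mem_Ici.mp (mt hi.mp hw)), rpowDecay, heaviside, if_neg hw]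
    ring

/-- The function `v ↦ Ψ(y^v, y) / y^v`, with `Ψ` counting only integers up to `N`. -/
noncomputable def smoothRatio (y : ℝ) (N : ℕ) (v : ℝ) : ℝ :=
  ∑ n ∈ smoothUpTo y N, (n : ℝ)⁻¹ * rpowDecay y (v - logRatio n y)

theorem logRatio_natCast_nonneg {y : ℝ} (hy : 2 ≤ y) (n : ℕ) : 0 ≤ logRatio n y :=
  div_nonneg (Real.log_natCast_nonneg n) (Real.log_nonneg (by linarith))

/-- The two conclusions are proved together because additivity in the inductive step needs the
partial sum to be causal. -/
theorem CausalBdd.realConv_sum {ι : Type*} {f : ℝ → ℝ} {g : ι → ℝ → ℝ} (s : Finset ι)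
    (hf : CausalBdd f) (hg : ∀ i ∈ s, CausalBdd (g i)) :
    CausalBdd (fun v => ∑ i ∈ s, g i v) ∧ ∀ u,
      _root_.realConv f (fun v => ∑ i ∈ s, g i v) u = ∑ i ∈ s, _root_.realConv f (g i) u := by
  classical
  induction s using Finset.induction_on with
  | empty =>
    refine ⟨⟨by simp, fun a => ⟨0, by simp⟩, by simp⟩, fun u => by simp [realConv_apply]⟩
  | insert i s hi ih =>
    obtain ⟨h1, h2⟩ := ih fun j hj => hg j (Finset.mem_insert_of_mem hj)
    have hgi := hg i (Finset.mem_insert_self i s)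
    have e : (fun v => ∑ j ∈ insert i s, g j v) = g i + fun v => ∑ j ∈ s, g j v := by
      ext v; simp [Finset.sum_insert hi]
    rw [e]
    refine ⟨hgi.add h1, fun u => ?_⟩
    rw [hf.realConv_add hgi h1, Pi.add_apply, h2, Finset.sum_insert hi]

theorem realConv_const_mul (f g : ℝ → ℝ) (c u : ℝ) :
    realConv f (fun v => c * g v) u = c * realConv f g u := by
  simp only [realConv_apply, ← integral_const_mul]
  exact integral_congr_ae (.of_forall fun t => by ring)

theorem smoothRatio_causalBdd {y : ℝ} (hy : 2 ≤ y) (N : ℕ) : CausalBdd (smoothRatio y N) :=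
  (CausalBdd.realConv_sum (smoothUpTo y N) heaviside_causalBdd fun n _ =>
    ((rpowDecay_causalBdd hy).shift (logRatio_natCast_nonneg hy n)).const_mul _).1

theorem realConv_smoothRatio {y : ℝ} (hy : 2 ≤ y) (N : ℕ) (u : ℝ) :
    realConv buchstabOmega (smoothRatio y N) u = ∑ n ∈ smoothUpTo y N,
      (n : ℝ)⁻¹ * realConv buchstabOmega (rpowDecay y) (u - logRatio n y) := by
  refine ((CausalBdd.realConv_sum (smoothUpTo y N) buchstabOmega_causalBdd fun n _ =>
    ((rpowDecay_causalBdd hy).shift (logRatio_natCast_nonneg hy n)).const_mul _).2 u).trans ?_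
  refine Finset.sum_congr rfl fun n _ => ?_
  rw [realConv_const_mul, realConv_shift]

theorem RStar_rpow_eq {y : ℝ} (hy : 2 ≤ y) (u : ℝ) :
    RStar (y ^ u) y = y ^ u * (smoothRatio y ⌊y ^ u⌋₊ u +
      realConv buchstabOmega (smoothRatio y ⌊y ^ u⌋₊) u) - ⌊y ^ u⌋₊ := by
  have h0 : 0 < y ^ u := Real.rpow_pos_of_pos (by linarith) _
  rw [RStar_eq_sum hy h0]
  simp only [QStar]
  rw [Finset.sum_sub_distrib, sum_roughCount h0.le, realConv_smoothRatio hy, smoothRatio,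
    ← Finset.sum_add_distrib, Finset.mul_sum]
  congr 1
  refine Finset.sum_congr rfl fun n hn => ?_
  have hn0 : (0 : ℝ) < n := by exact_mod_cast (mem_smoothUpTo.mp hn).1.1
  have e : y ^ u / n = y ^ (u - logRatio n y) := by
    rw [Real.rpow_sub (by linarith), rpow_logRatio hy hn0]
  rw [e, VStar_rpow hy, ← e]
  ring

/-- A cutoff `N` independent of `v` keeps `smoothRatio` a fixed finite sum of translates; the terms
with `n > y^v` are removed by the Heaviside factor. -/
theorem rpow_mul_smoothRatio {y : ℝ} (hy : 2 ≤ y) {v : ℝ} {N : ℕ} (hvN : ⌊y ^ v⌋₊ ≤ N) :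
    y ^ v * smoothRatio y N v = smoothCount (y ^ v) y := by
  have hy0 : 0 < y := by linarith
  have h0 : 0 < y ^ v := Real.rpow_pos_of_pos hy0 _
  have hs : smoothUpTo y ⌊y ^ v⌋₊ = (smoothUpTo y N).filter (fun n : ℕ => (n : ℝ) ≤ y ^ v) := by
    ext n
    simp only [mem_smoothUpTo, Finset.mem_filter, Nat.le_floor_iff h0.le]
    constructor
    · exact fun h => ⟨⟨h.1, ((Nat.le_floor_iff h0.le).mpr h.2).trans hvN⟩, h.2⟩
    · exact fun h => ⟨h.1.1, h.2⟩
  rw [smoothCount_eq_card h0.le, hs, Finset.card_filter, smoothRatio, Finset.mul_sum]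
  push_cast
  refine Finset.sum_congr rfl fun n hn => ?_
  have hn0 : (0 : ℝ) < n := by exact_mod_cast (mem_smoothUpTo.mp hn).1.1
  have hi : (n : ℝ) ≤ y ^ v ↔ 0 ≤ v - logRatio n y := by
    conv_lhs => rw [← rpow_logRatio hy hn0]
    rw [Real.rpow_le_rpow_left_iff (by linarith), sub_nonneg]
  by_cases h : (n : ℝ) ≤ y ^ v
  · rw [if_pos h, rpowDecay, heaviside, if_pos (hi.mp h), neg_sub, Real.rpow_sub hy0,
      rpow_logRatio hy hn0]
    field_simp
  · rw [if_neg h, rpowDecay, heaviside, if_neg (mt hi.mpr h)]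
    ring

/-- The function `v ↦ Λ(y^v, y) / y^v`. -/
noncomputable def lambdaRatio (y : ℝ) : ℝ → ℝ :=
  (heaviside - fractRatio y) + realConv (heaviside - fractRatio y) dickmanRhoDeriv

theorem heaviside_sub_fractRatio_causalBdd {y : ℝ} (hy : 2 ≤ y) :
    CausalBdd (heaviside - fractRatio y) :=
  heaviside_causalBdd.sub (fractRatio_causalBdd hy)

theorem lambdaRatio_causalBdd {y : ℝ} (hy : 2 ≤ y) : CausalBdd (lambdaRatio y) :=
  (heaviside_sub_fractRatio_causalBdd hy).add
    ((heaviside_sub_fractRatio_causalBdd hy).realConv dickmanRhoDeriv_causalBdd)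

theorem rpow_mul_lambdaRatio {y : ℝ} (hy : 2 ≤ y) {v : ℝ} (hv : 0 ≤ v) :
    y ^ v * lambdaRatio y v = deBruijnLambda (y ^ v) y := by
  have h0 : 0 < y ^ v := Real.rpow_pos_of_pos (by linarith) _
  have hI : ∫ t in (0 : ℝ)..v, dickmanRhoDeriv (v - t) * (Int.fract (y ^ t) / y ^ t) =
      realConv dickmanRhoDeriv (fractRatio y) v := by
    rw [dickmanRhoDeriv_causalBdd.realConv_eq_intervalIntegral (fractRatio_causalBdd hy)]
    refine intervalIntegral.integral_congr fun t ht => ?_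
    rw [Set.uIcc_of_le hv] at ht
    simp [fractRatio, heaviside, ht.1]
  rw [deBruijnLambda, logRatio_rpow hy, hI, lambdaRatio, CausalBdd.sub_realConv
    heaviside_causalBdd (fractRatio_causalBdd hy) dickmanRhoDeriv_causalBdd,
    congrFun dickmanRho_eq_heaviside_add v, realConv_comm dickmanRhoDeriv]
  simp only [Pi.add_apply, Pi.sub_apply]
  have : y ^ v * fractRatio y v = Int.fract (y ^ v) := by
    simp only [fractRatio, heaviside, hv, if_true]; field_simp
  linear_combination -this

/-! ### The bound for `R*`. -/

theorem abs_RStar_le {X y c : ℝ} (hy : 2 ≤ y)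
    (hΔ : ∀ x : ℝ, 1 ≤ x → x ≤ X →
      |smoothError x y| ≤ x * c * dickmanRho (logRatio x y))
    {x : ℝ} (hx : 1 ≤ x) (hxX : x ≤ X) : |RStar x y| ≤ x * c := by
  have hy1 : 1 < y := by linarith
  set u := logRatio x y with hu
  have hxu : y ^ u = x := rpow_logRatio hy (by linarith)
  have hu0 : 0 ≤ u := div_nonneg (Real.log_nonneg hx) (Real.log_nonneg hy1.le)
  set N := ⌊x⌋₊
  have hψ := smoothRatio_causalBdd hy N
  have hl := lambdaRatio_causalBdd hy
  have hω := buchstabOmega_causalBdd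
  have hρ := dickmanRho_causalBdd
  set δ : ℝ → ℝ := smoothRatio y N - lambdaRatio y with hδdef
  have hδ : CausalBdd δ := hψ.sub hl
  have hbound : ∀ v, 0 ≤ v → v ≤ u → |δ v| ≤ c * dickmanRho v := by
    intro v hv hvu
    have h1 : 1 ≤ y ^ v := Real.one_le_rpow hy1.le hv
    have h2 : y ^ v ≤ x := hxu ▸ Real.rpow_le_rpow_of_exponent_le hy1.le hvu
    have h3 := hΔ _ h1 (h2.trans hxX)
    rw [logRatio_rpow hy, smoothError, ← rpow_mul_lambdaRatio hy hv,
      ← rpow_mul_smoothRatio hy (Nat.floor_le_floor h2), ← mul_sub, abs_mul,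
      abs_of_pos (by linarith), mul_assoc] at h3
    exact le_of_mul_le_mul_left h3 (by linarith)
  have hR : RStar x y = x * (δ u + realConv buchstabOmega δ u) := by
    have h1 := RStar_rpow_eq hy u
    rw [hxu] at h1
    have h2 := congrFun (add_conv_buchstabOmega (heaviside_sub_fractRatio_causalBdd hy)) u
    have h2' : lambdaRatio y u + realConv (lambdaRatio y) buchstabOmega u =
      heaviside u - fractRatio y u := h2
    -- Here `1 - {x}/x = ⌊x⌋/x`, so the main term of `Λ` reproduces exactly the sum of `Φ(x/n, y)`.
    have h3 : x * (heaviside u - fractRatio y u) = N := by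
      have hx0 : x ≠ 0 := by linarith
      simp only [heaviside, fractRatio, hu0, if_true, hxu]
      have := Int.self_sub_fract x
      have h4 : ((⌊x⌋ : ℤ) : ℝ) = N := (natCast_floor_eq_intCast_floor (by linarith)).symm
      field_simp
      linarith
    have h5 : realConv buchstabOmega δ u =
        realConv buchstabOmega (smoothRatio y N) u - realConv (lambdaRatio y) buchstabOmega u := by
      rw [realConv_comm, hδdef, CausalBdd.sub_realConv hψ hl hω, realConv_comm buchstabOmega]
      rfl
    rw [h1, h5, ← h3, ← h2', hδdef, Pi.sub_apply]
    ring
  -- Nonnegativity of `ω` transfers the pointwise bound on `δ` to the convolution, which only sees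
  -- `δ` on `[0, u]`.
  have hconv : |realConv buchstabOmega δ u| ≤ c * realConv buchstabOmega dickmanRho u := by
    rw [← realConv_const_mul, realConv_apply, realConv_apply, ← Real.norm_eq_abs]
    refine norm_integral_le_of_norm_le (hω.convolutionExistsAt (hρ.const_mul c) u)
      (.of_forall fun t => ?_)
    rw [Real.norm_eq_abs]
    by_cases ht : t ∈ Set.Icc 0 u
    · rw [abs_mul, abs_of_nonneg (buchstabOmega_nonneg t)]
      exact mul_le_mul_of_nonneg_left (hbound _ (by linarith [ht.2]) (by linarith [ht.1]))
        (buchstabOmega_nonneg t)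
    · rw [hω.conv_integrand_eq_zero hδ ht, hω.conv_integrand_eq_zero (hρ.const_mul c) ht]
      simp
  have hone : dickmanRho u + realConv buchstabOmega dickmanRho u = 1 := by
    have := congrFun dickmanRho_add_conv_buchstabOmega u
    rw [realConv_comm] at this
    simpa [heaviside, hu0] using this
  rw [hR, abs_mul, abs_of_pos (by linarith)]
  refine mul_le_mul_of_nonneg_left ?_ (by linarith)
  calc _ ≤ |δ u| + |realConv buchstabOmega δ u| := abs_add_le _ _
    _ ≤ c * dickmanRho u + c * realConv buchstabOmega dickmanRho u :=
      add_le_add (hbound u hu0 le_rfl) hconv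
    _ = c := by rw [← mul_add, hone, mul_one]

/-! ### Möbius inversion and the bound for `Q*`. -/

open scoped ArithmeticFunction.Moebius in
theorem sum_divisors_filter_dvd_moebius {P : ℕ} (hP : P ≠ 0) (m : ℕ) :
    ∑ d ∈ P.divisors.filter (· ∣ m), μ d = if P.gcd m = 1 then 1 else 0 := by
  have e : P.divisors.filter (· ∣ m) = (P.gcd m).divisors := by
    ext d
    simp only [Finset.mem_filter, Nat.mem_divisors, Nat.dvd_gcd_iff]
    have : P.gcd m ≠ 0 := fun h => hP (Nat.eq_zero_of_gcd_eq_zero_left h)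
    tauto
  rw [e, ← ArithmeticFunction.coe_mul_zeta_apply, ArithmeticFunction.moebius_mul_coe_zeta,
    ArithmeticFunction.one_apply]

/-- The product of the primes up to `y`. -/
noncomputable def primesProduct (y : ℝ) : ℕ := ∏ p ∈ (Finset.Icc 1 ⌊y⌋₊).filter Nat.Prime, p

theorem primesProduct_ne_zero (y : ℝ) : primesProduct y ≠ 0 :=
  Finset.prod_ne_zero_iff.mpr fun _ hp => (Finset.mem_filter.mp hp).2.ne_zero

theorem primeFactors_primesProduct (y : ℝ) :
    (primesProduct y).primeFactors = (Finset.Icc 1 ⌊y⌋₊).filter Nat.Prime :=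
  Nat.primeFactors_prod fun _ hp => (Finset.mem_filter.mp hp).2

theorem squarefree_primesProduct (y : ℝ) : Squarefree (primesProduct y) := by
  refine Finset.squarefree_prod_of_pairwise_isCoprime ?_ fun p hp =>
    (Finset.mem_filter.mp hp).2.squarefree
  intro p hp q hq hpq
  exact Nat.coprime_iff_isRelPrime.mp ((Nat.coprime_primes (Finset.mem_filter.mp hp).2
    (Finset.mem_filter.mp hq).2).mpr hpq)

theorem prime_dvd_primesProduct_iff {y : ℝ} (hy : 0 ≤ y) {p : ℕ} (hp : p.Prime) :
    p ∣ primesProduct y ↔ (p : ℝ) ≤ y := by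
  have h : p ∣ primesProduct y ↔ p ∈ (primesProduct y).primeFactors := by
    simp [hp, primesProduct_ne_zero]
  rw [h, primeFactors_primesProduct, Finset.mem_filter, Finset.mem_Icc, Nat.le_floor_iff hy]
  exact ⟨fun h => h.1.2, fun h => ⟨⟨hp.one_le, h⟩, hp⟩⟩

theorem mem_smoothSet_of_dvd_primesProduct {y : ℝ} (hy : 0 ≤ y) {d : ℕ}
    (hd : d ∣ primesProduct y) : d ∈ smoothSet y :=
  ⟨Nat.pos_of_dvd_of_pos hd (Nat.pos_of_ne_zero (primesProduct_ne_zero y)),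
    fun _ hp h => (prime_dvd_primesProduct_iff hy hp).mp (h.trans hd)⟩

theorem gcd_primesProduct_eq_one_iff {y : ℝ} (hy : 0 ≤ y) {m : ℕ} (hm : m ∈ smoothSet y) :
    (primesProduct y).gcd m = 1 ↔ m = 1 := by
  refine ⟨fun h => ?_, fun h => by simp [h]⟩
  by_contra hne
  obtain ⟨p, hp, hpm⟩ := Nat.exists_prime_and_dvd hne
  have := Nat.dvd_gcd ((prime_dvd_primesProduct_iff hy hp).mpr (hm.2 p hp hpm)) hpm
  rw [h] at this
  exact hp.ne_one (Nat.dvd_one.mp this)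

theorem RStar_div_eq_sum {x y : ℝ} (hy : 2 ≤ y) (hx : 0 < x) {d : ℕ} (hd : d ∈ smoothSet y) :
    RStar (x / d) y = ∑ m ∈ (smoothUpTo y ⌊x⌋₊).filter (d ∣ ·), QStar (x / m) y := by
  have hd0 : (0 : ℝ) < d := by exact_mod_cast hd.1
  rw [RStar_eq_sum hy (by positivity), Nat.floor_div_natCast]
  refine Finset.sum_bij (fun k _ => d * k) ?_ ?_ ?_ ?_
  · intro k hk
    rw [mem_smoothUpTo] at hk
    rw [Finset.mem_filter, mem_smoothUpTo]
    refine ⟨⟨mul_mem_smoothSet hd hk.1, ?_⟩, dvd_mul_right d k⟩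
    rw [mul_comm]; exact (Nat.le_div_iff_mul_le hd.1).mp hk.2
  · intro a _ b _ h
    exact Nat.eq_of_mul_eq_mul_left hd.1 h
  · intro m hm
    rw [Finset.mem_filter, mem_smoothUpTo] at hm
    obtain ⟨⟨hm, hmx⟩, k, rfl⟩ := hm
    refine ⟨k, mem_smoothUpTo.mpr ⟨mem_smoothSet_of_dvd hm (dvd_mul_left k d), ?_⟩, rfl⟩
    rw [Nat.le_div_iff_mul_le hd.1, mul_comm]; exact hmx
  · intro k _
    push_cast
    rw [div_div]

open scoped ArithmeticFunction.Moebius in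
/-- Möbius inversion of the definition of `R*`. -/
theorem QStar_eq_sum_moebius {x y : ℝ} (hy : 2 ≤ y) (hx : 1 ≤ x) :
    QStar x y = ∑ d ∈ (primesProduct y).divisors, (μ d : ℝ) * RStar (x / d) y := by
  have hy0 : 0 ≤ y := by linarith
  have h1 : ∀ d ∈ (primesProduct y).divisors, (μ d : ℝ) * RStar (x / d) y =
      ∑ m ∈ smoothUpTo y ⌊x⌋₊, if d ∣ m then (μ d : ℝ) * QStar (x / m) y else 0 := by
    intro d hd
    rw [RStar_div_eq_sum hy (by linarith)
      (mem_smoothSet_of_dvd_primesProduct hy0 (Nat.dvd_of_mem_divisors hd)),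
      Finset.mul_sum, Finset.sum_filter]
  -- After exchanging the sums, the Möbius sum detects `gcd(P, m) = 1`; for smooth `m` this forces
  -- `m = 1`.
  have h2 : ∀ m ∈ smoothUpTo y ⌊x⌋₊, (∑ d ∈ (primesProduct y).divisors,
      if d ∣ m then (μ d : ℝ) * QStar (x / m) y else 0) =
      if m = 1 then QStar (x / m) y else 0 := by
    intro m hm
    rw [← Finset.sum_filter, ← Finset.sum_mul, ← Int.cast_sum,
      sum_divisors_filter_dvd_moebius (primesProduct_ne_zero y)]
    simp only [gcd_primesProduct_eq_one_iff hy0 (mem_smoothUpTo.mp hm).1]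
    split_ifs <;> simp
  rw [Finset.sum_congr rfl h1, Finset.sum_comm, Finset.sum_congr rfl h2,
    Finset.sum_ite_eq' (smoothUpTo y ⌊x⌋₊) 1 (fun m : ℕ => QStar (x / m) y), if_pos]
  · simp
  · exact mem_smoothUpTo.mpr ⟨one_mem_smoothSet y, Nat.le_floor (by simpa using hx)⟩

/-- The divisor sum of a squarefree number factors as `∏ (1 + 1/p)`, and `(1 + t)(1 - t) ≤ 1` with
`t = 1/p`. -/
theorem sum_divisors_primesProduct_inv (y : ℝ) :
    ∑ d ∈ (primesProduct y).divisors, (d : ℝ)⁻¹ ≤ (primeProd y)⁻¹ := by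
  let g : ArithmeticFunction ℝ := ⟨fun n => (n : ℝ)⁻¹, by simp⟩
  have hg : g.IsMultiplicative := ⟨by simp [g], fun {m n} _ => by simp [g, mul_comm]⟩
  have h := hg.prodPrimeFactors_one_add_of_squarefree (squarefree_primesProduct y)
  have h' : ∑ d ∈ (primesProduct y).divisors, (d : ℝ)⁻¹ =
      ∏ p ∈ (primesProduct y).primeFactors, (1 + (p : ℝ)⁻¹) := h.symm
  rw [h', primeFactors_primesProduct, primeProd, ← Finset.prod_inv_distrib]
  refine Finset.prod_le_prod (fun p _ => by positivity) fun p hp => ?_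
  have hp2 : (2 : ℝ) ≤ p := by exact_mod_cast (Finset.mem_filter.mp hp).2.two_le
  have hinv : (p : ℝ)⁻¹ ≤ 2⁻¹ := inv_anti₀ two_pos hp2
  rw [one_div, inv_eq_one_div (1 - (p : ℝ)⁻¹), le_div_iff₀ (by linarith)]
  nlinarith [sq_nonneg (p : ℝ)⁻¹]

theorem corollary3 (X y : ℝ) (hX : 1 ≤ X) (hy : 2 ≤ y) (f : ℝ → ℝ) (hf : 0 < f y)
    (hΔ : ∀ x : ℝ, 1 ≤ x → x ≤ X →
      |smoothError x y| ≤ x * f y * dickmanRho (logRatio x y)) :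
    (∀ x : ℝ, 1 ≤ x → x ≤ X → |RStar x y| ≤ x * f y) ∧
    (∀ x : ℝ, 1 ≤ x → x ≤ X → |QStar x y| ≤ x * f y * (primeProd y)⁻¹) := by
  have hR : ∀ x : ℝ, 1 ≤ x → x ≤ X → |RStar x y| ≤ x * f y :=
    fun x hx hxX => abs_RStar_le hy hΔ hx hxX
  refine ⟨hR, fun x hx hxX => ?_⟩
  have hxf : 0 < x * f y := mul_pos (by linarith) hf
  rw [QStar_eq_sum_moebius hy hx]
  calc _ ≤ ∑ d ∈ (primesProduct y).divisors, x * f y * (d : ℝ)⁻¹ := by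
        refine (Finset.abs_sum_le_sum_abs _ _).trans (Finset.sum_le_sum fun d hd => ?_)
        have hd0 : (1 : ℝ) ≤ d := by exact_mod_cast Nat.pos_of_mem_divisors hd
        have hxd : x / d ≤ x := div_le_self (by linarith) hd0
        have hμ : |(ArithmeticFunction.moebius d : ℝ)| ≤ 1 := by
          exact_mod_cast ArithmeticFunction.abs_moebius_le_one
        have hRd : |RStar (x / d) y| ≤ x * f y * (d : ℝ)⁻¹ := by
          rcases le_or_gt 1 (x / d) with h | h
          · exact (hR _ h (hxd.trans hxX)).trans_eq (by ring)
          -- Below `1` the bound on `R*` is not available, but there `R*` is an empty sum.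
          · have : smoothUpTo y 0 = ∅ := by simp [smoothUpTo]
            rw [RStar_eq_sum hy (by positivity), Nat.floor_eq_zero.mpr h, this]
            simp only [Finset.sum_empty, abs_zero]
            positivity
        rw [abs_mul]
        exact (mul_le_of_le_one_left (abs_nonneg _) hμ).trans hRd
    _ = x * f y * ∑ d ∈ (primesProduct y).divisors, (d : ℝ)⁻¹ := by rw [Finset.mul_sum]
    _ ≤ _ := mul_le_mul_of_nonneg_left (sum_divisors_primesProduct_inv y) hxf.le
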